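/- Identify $\mathbb{R}^2$ with $\mathbb{C}$ via $z=x_1+ix_2$ and put $\partial_{\bar z}=\frac12(\partial_1+i\partial_2)$, $\partial_z=\frac12(\partial_1-i\partial_2)$. For a magnetic field $B\in L^\infty(\mathbb{R}^2;\mathbb{R})$, a generating potential of $B$ is a real-valued $h\in L^1_{loc}(\mathbb{R}^2)$ with $\Delta h=B$ in the sense of distributions. The Pauli operators with magnetic field $B$ are the operators $H_h$ on $L^2(\mathbb{R}^2,\mathbb{C}^2)$, one for each generating potential $h$ of $B$, where $H_h$ is the operator associated with the closed quadratic form $$\pi^h(\psi,\psi)=4\int_{\mathbb{R}^2}\big|\partial_{\bar z}(e^{-h}\psi_+)\big|^2e^{2h}+4\int_{\mathbb{R}^2}\big|\partial_{z}(e^{h}\psi_-)\big|^2e^{-2h},\qquad \psi=\begin{pmatrix}\psi_+\\ \psi_-\end{pmatrix},$$ on its maximal domain $\{\psi\in L^2(\mathbb{R}^2,\mathbb{C}^2):\pi^h(\psi,\psi)<\infty\}$ (derivatives in the sense of distributions). **Counterexample.** There exists a continuous bounded magnetic field $B:\mathbb{R}^2\to\mathbb{R}$ with $\int_{\mathbb{R}^2}|B|=\infty$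 such that the limit $$\Phi:=\lim_{r\to\infty}\frac1{2\pi}\int_{|x|\le r}B(x)\,dx$$ exists (as a real number) and $\Phi>1$, but $\dim\operatorname{Ker}H=0$ for every Pauli operator $H$ with magnetic field $B$ (and $B$ has a generating potential, so that such operators exist). In particular the Aharonov–Casher formula $\dim\operatorname{Ker}H=\lfloor|\Phi|\rfloor$ fails for $B$; here $\lfloor x\rfloor$ denotes the largest integer strictly less than $x$ for $x>0$, and $\lfloor 0\rfloor=0$. -/

import Mathlib

open MeasureTheory Filter Topology Set
open scoped ContDiff ComplexConjugate InnerProductSpace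

noncomputable section

namespace Pauli

/-! The plane is identified with `ℂ`, with its Lebesgue measure, through `z = x₁ + i x₂`. -/

/-- Test functions: smooth, compactly supported, complex valued functions on the plane. -/
structure IsTestFunction (φ : ℂ → ℂ) : Prop where
  smooth : ContDiff ℝ ∞ φ
  compact : HasCompactSupport φ

/-- The differential operator `(∂₁ + c ∂₂) / 2`. It is `∂/∂z̄` for `c = i` and `∂/∂z` for
`c = -i`. -/
def wirtinger (c : ℂ) (φ : ℂ → ℂ) (z : ℂ) : ℂ :=
  (1 / 2) * (fderiv ℝ φ z 1 + c * fderiv ℝ φ z Complex.I)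

/-- `(∂₁ + c ∂₂) f / 2 = u` in the sense of distributions, for locally integrable `f`, `u`. -/
structure IsWeakWirtinger (c : ℂ) (f u : ℂ → ℂ) : Prop where
  left : LocallyIntegrable f volume
  right : LocallyIntegrable u volume
  integral_eq : ∀ φ : ℂ → ℂ, IsTestFunction φ →
    ∫ z, f z * wirtinger c φ z = - ∫ z, u z * φ z

open Classical in
/-- The function that represents the distribution `(∂₁ + c ∂₂) f / 2`, if there is one.
It is unique up to null sets. -/
def weakWirtinger (c : ℂ) (f : ℂ → ℂ) : ℂ → ℂ :=
  if H : ∃ u, IsWeakWirtinger c f u then H.choose else 0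

/-- `Δ h = B` in the sense of distributions, with `h` real valued and locally integrable:
`h` is a generating potential of the magnetic field `B`. -/
structure IsGeneratingPotential (h B : ℂ → ℝ) : Prop where
  locallyIntegrable : LocallyIntegrable h volume
  integral_eq : ∀ φ : ℂ → ℝ, ContDiff ℝ ∞ φ → HasCompactSupport φ →
    ∫ z, h z * Laplacian.laplacian φ z = ∫ z, B z * φ z

/-- The product `e^{-h} f`. -/
def twist (h : ℂ → ℝ) (f : ℂ → ℂ) (z : ℂ) : ℂ := (Real.exp (-h z) : ℂ) * f z

/-- The distribution `D (e^{-h} f)`, with `D = (∂₁ + c ∂₂) / 2`, is a function and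
`∫ |D (e^{-h} f)|² e^{2h} < ∞`. -/
structure HasFiniteEnergy (c : ℂ) (h : ℂ → ℝ) (f : ℂ → ℂ) : Prop where
  exists_weak : ∃ u, IsWeakWirtinger c (twist h f) u
  memLp : MemLp (fun z => (Real.exp (h z) : ℂ) * weakWirtinger c (twist h f) z) 2 volume

/-- The sesquilinear form `4 ∫ conj (D (e^{-h} f)) D (e^{-h} g) e^{2h}`, where
`D = (∂₁ + c ∂₂) / 2`. -/
def componentForm (c : ℂ) (h : ℂ → ℝ) (f g : ℂ → ℂ) : ℂ :=
  4 * ∫ z, conj (weakWirtinger c (twist h f) z) * weakWirtinger c (twist h g) z *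
    (Real.exp (2 * h z) : ℂ)

/-- The Hilbert space `L²(ℝ², ℂ²)` of spinors. -/
abbrev Spinor : Type := Lp (EuclideanSpace ℂ (Fin 2)) 2 (volume : Measure ℂ)

/-- The spin-up component. -/
def up (ψ : Spinor) (z : ℂ) : ℂ := ψ z 0

/-- The spin-down component. -/
def down (ψ : Spinor) (z : ℂ) : ℂ := ψ z 1

/-- The Pauli form
`π^h(ψ, ξ) = 4 ∫ conj (∂_z̄ (e^{-h} ψ₊)) ∂_z̄ (e^{-h} ξ₊) e^{2h}
  + 4 ∫ conj (∂_z (e^{h} ψ₋)) ∂_z (e^{h} ξ₋) e^{-2h}`. -/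
def pauliForm (h : ℂ → ℝ) (ψ ξ : Spinor) : ℂ :=
  componentForm Complex.I h (up ψ) (up ξ) + componentForm (-Complex.I) (-h) (down ψ) (down ξ)

section Helpers

variable {c : ℂ} {h : ℂ → ℝ} {f g u v : ℂ → ℂ}

theorem continuous_wirtinger (c : ℂ) {φ : ℂ → ℂ} (hφ : IsTestFunction φ) :
    Continuous (wirtinger c φ) := by
  have := hφ.smooth.continuous_fderiv (by simp)
  unfold wirtinger
  fun_prop

theorem hasCompactSupport_wirtinger (c : ℂ) {φ : ℂ → ℂ} (hφ : IsTestFunction φ) :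
    HasCompactSupport (wirtinger c φ) := by
  have h1 : HasCompactSupport (fderiv ℝ φ) := hφ.compact.fderiv ℝ
  exact h1.comp_left (g := fun L : ℂ →L[ℝ] ℂ => (1 / 2) * (L 1 + c * L Complex.I)) (by simp)

theorem integrable_mul_test (hf : LocallyIntegrable f volume) {φ : ℂ → ℂ} (hφ : Continuous φ)
    (hc : HasCompactSupport φ) : Integrable (fun z => f z * φ z) volume :=
  hf.integrable_smul_right_of_hasCompactSupport hφ hc

theorem IsWeakWirtinger.add (hf : IsWeakWirtinger c f u) (hg : IsWeakWirtinger c g v) :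
    IsWeakWirtinger c (f + g) (u + v) where
  left := hf.left.add hg.left
  right := hf.right.add hg.right
  integral_eq φ hφ := by
    have a1 := continuous_wirtinger c hφ
    have a2 := hasCompactSupport_wirtinger c hφ
    have b1 := hφ.smooth.continuous
    simp only [Pi.add_apply, add_mul]
    rw [integral_add (integrable_mul_test hf.left a1 a2) (integrable_mul_test hg.left a1 a2),
      integral_add (integrable_mul_test hf.right b1 hφ.compact)
        (integrable_mul_test hg.right b1 hφ.compact), hf.integral_eq φ hφ, hg.integral_eq φ hφ]
    ring

theorem IsWeakWirtinger.smul (a : ℂ) (hf : IsWeakWirtinger c f u) :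
    IsWeakWirtinger c (a • f) (a • u) where
  left := hf.left.smul a
  right := hf.right.smul a
  integral_eq φ hφ := by
    simp only [Pi.smul_apply, smul_eq_mul, mul_assoc]
    rw [integral_const_mul, integral_const_mul, hf.integral_eq φ hφ]
    ring

theorem IsWeakWirtinger.congr (hf : IsWeakWirtinger c f u) (hfg : f =ᵐ[volume] g) :
    IsWeakWirtinger c g u where
  left := hf.left.congr hfg
  right := hf.right
  integral_eq φ hφ := by
    rw [← hf.integral_eq φ hφ]
    refine integral_congr_ae ?_
    filter_upwards [hfg] with z hz
    rw [hz]

theorem IsWeakWirtinger.unique (hu : IsWeakWirtinger c f u) (hv : IsWeakWirtinger c f v) :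
    u =ᵐ[volume] v := by
  refine ae_eq_of_integral_contDiff_smul_eq hu.right hv.right fun g hg hgc => ?_
  have hφ : IsTestFunction (fun z => (g z : ℂ)) :=
    ⟨Complex.ofRealCLM.contDiff.comp hg, hgc.comp_left (g := Complex.ofReal) rfl⟩
  have h1 := hu.integral_eq _ hφ
  rw [hv.integral_eq _ hφ, neg_inj] at h1
  simpa only [Complex.real_smul, mul_comm] using h1.symm

theorem isWeakWirtinger_weakWirtinger (H : ∃ u, IsWeakWirtinger c f u) :
    IsWeakWirtinger c f (weakWirtinger c f) := by
  rw [weakWirtinger, dif_pos H]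
  exact H.choose_spec

theorem IsWeakWirtinger.weakWirtinger_ae (hu : IsWeakWirtinger c f u) :
    weakWirtinger c f =ᵐ[volume] u :=
  (isWeakWirtinger_weakWirtinger ⟨u, hu⟩).unique hu

theorem up_add (ψ ξ : Spinor) : up (ψ + ξ) =ᵐ[volume] up ψ + up ξ := by
  filter_upwards [Lp.coeFn_add ψ ξ] with z hz
  simp only [up, hz, Pi.add_apply, PiLp.add_apply]

theorem down_add (ψ ξ : Spinor) : down (ψ + ξ) =ᵐ[volume] down ψ + down ξ := by
  filter_upwards [Lp.coeFn_add ψ ξ] with z hz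
  simp only [down, hz, Pi.add_apply, PiLp.add_apply]

theorem up_smul (a : ℂ) (ψ : Spinor) : up (a • ψ) =ᵐ[volume] a • up ψ := by
  filter_upwards [Lp.coeFn_smul a ψ] with z hz
  simp only [up, hz, Pi.smul_apply, PiLp.smul_apply]

theorem down_smul (a : ℂ) (ψ : Spinor) : down (a • ψ) =ᵐ[volume] a • down ψ := by
  filter_upwards [Lp.coeFn_smul a ψ] with z hz
  simp only [down, hz, Pi.smul_apply, PiLp.smul_apply]

theorem up_zero : up 0 =ᵐ[volume] 0 := by
  filter_upwards [Lp.coeFn_zero (EuclideanSpace ℂ (Fin 2)) 2 (volume : Measure ℂ)] with z hz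
  simp only [up, hz, Pi.zero_apply, PiLp.zero_apply]

theorem down_zero : down 0 =ᵐ[volume] 0 := by
  filter_upwards [Lp.coeFn_zero (EuclideanSpace ℂ (Fin 2)) 2 (volume : Measure ℂ)] with z hz
  simp only [down, hz, Pi.zero_apply, PiLp.zero_apply]

theorem twist_congr (h : ℂ → ℝ) (hfg : f =ᵐ[volume] g) : twist h f =ᵐ[volume] twist h g := by
  filter_upwards [hfg] with z hz
  simp [twist, hz]

theorem twist_add (h : ℂ → ℝ) (f g : ℂ → ℂ) : twist h (f + g) = twist h f + twist h g := by
  ext z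
  simp [twist, mul_add]

theorem twist_smul (h : ℂ → ℝ) (a : ℂ) (f : ℂ → ℂ) : twist h (a • f) = a • twist h f := by
  ext z
  simp [twist, mul_left_comm]

theorem HasFiniteEnergy.congr (hf : HasFiniteEnergy c h f) (hfg : f =ᵐ[volume] g) :
    HasFiniteEnergy c h g := by
  have h1 := (isWeakWirtinger_weakWirtinger hf.exists_weak).congr (twist_congr h hfg)
  refine ⟨⟨_, h1⟩, hf.memLp.ae_eq ?_⟩
  filter_upwards [h1.weakWirtinger_ae] with z hz
  rw [hz]

theorem weakWirtinger_add (hf : HasFiniteEnergy c h f) (hg : HasFiniteEnergy c h g)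
    (hu : u =ᵐ[volume] f + g) : IsWeakWirtinger c (twist h u)
      (weakWirtinger c (twist h f) + weakWirtinger c (twist h g)) := by
  refine IsWeakWirtinger.congr (f := twist h f + twist h g) ?_ ?_
  · exact (isWeakWirtinger_weakWirtinger hf.exists_weak).add
      (isWeakWirtinger_weakWirtinger hg.exists_weak)
  · rw [← twist_add]
    exact (twist_congr h hu).symm

theorem weakWirtinger_smul (a : ℂ) (hf : HasFiniteEnergy c h f)
    (hu : u =ᵐ[volume] a • f) : IsWeakWirtinger c (twist h u)
      (a • weakWirtinger c (twist h f)) := by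
  refine IsWeakWirtinger.congr (f := a • twist h f) ?_ ?_
  · exact (isWeakWirtinger_weakWirtinger hf.exists_weak).smul a
  · rw [← twist_smul]
    exact (twist_congr h hu).symm

theorem HasFiniteEnergy.add (hf : HasFiniteEnergy c h f) (hg : HasFiniteEnergy c h g) :
    HasFiniteEnergy c h (f + g) := by
  have h1 := weakWirtinger_add hf hg (ae_eq_refl (f + g))
  refine ⟨⟨_, h1⟩, (hf.memLp.add hg.memLp).ae_eq ?_⟩
  filter_upwards [h1.weakWirtinger_ae] with z hz
  simp [hz, mul_add]

theorem HasFiniteEnergy.smul (a : ℂ) (hf : HasFiniteEnergy c h f) :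
    HasFiniteEnergy c h (a • f) := by
  have h1 := weakWirtinger_smul a hf (ae_eq_refl (a • f))
  refine ⟨⟨_, h1⟩, (hf.memLp.const_smul a).ae_eq ?_⟩
  filter_upwards [h1.weakWirtinger_ae] with z hz
  simp [hz, mul_left_comm]

theorem hasFiniteEnergy_zero : HasFiniteEnergy c h 0 := by
  have h0 : twist h 0 = 0 := by
    ext z
    simp [twist]
  have h1 : IsWeakWirtinger c (twist h 0) 0 := by
    rw [h0]
    exact ⟨locallyIntegrable_zero, locallyIntegrable_zero, by simp⟩
  refine ⟨⟨_, h1⟩, (MemLp.zero (ε := ℂ) (p := 2) (μ := volume)).ae_eq ?_⟩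
  filter_upwards [h1.weakWirtinger_ae] with z hz
  simp [hz]

theorem integrable_componentForm (hf : HasFiniteEnergy c h f) (hg : HasFiniteEnergy c h g) :
    Integrable (fun z => conj (weakWirtinger c (twist h f) z) * weakWirtinger c (twist h g) z *
      (Real.exp (2 * h z) : ℂ)) volume := by
  refine (hf.memLp.star.integrable_mul hg.memLp).congr (.of_forall fun z => ?_)
  have : Real.exp (2 * h z) = Real.exp (h z) * Real.exp (h z) := by
    rw [← Real.exp_add, two_mul]
  simp only [Pi.mul_apply, Pi.star_apply, this, star_mul', RCLike.star_def, Complex.conj_ofReal]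
  push_cast
  ring

theorem componentForm_add (hf : HasFiniteEnergy c h f) (hg : HasFiniteEnergy c h g)
    (hv : HasFiniteEnergy c h v) (hu : u =ᵐ[volume] f + g) :
    componentForm c h u v = componentForm c h f v + componentForm c h g v := by
  simp only [componentForm]
  rw [← mul_add, ← integral_add (integrable_componentForm hf hv) (integrable_componentForm hg hv)]
  congr 1
  refine integral_congr_ae ?_
  filter_upwards [(weakWirtinger_add hf hg hu).weakWirtinger_ae] with z hz
  simp only [hz, Pi.add_apply, map_add]
  ring

theorem componentForm_smul (a : ℂ) (hf : HasFiniteEnergy c h f) (hu : u =ᵐ[volume] a • f) :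
    componentForm c h u v = conj a * componentForm c h f v := by
  simp only [componentForm]
  rw [mul_left_comm, ← integral_const_mul (conj a)]
  congr 1
  refine integral_congr_ae ?_
  filter_upwards [(weakWirtinger_smul a hf hu).weakWirtinger_ae] with z hz
  simp only [hz, Pi.smul_apply, smul_eq_mul, map_mul]
  ring

end Helpers

/-- The maximal form domain `D(π^h) = {ψ ∈ L²(ℝ², ℂ²) : π^h(ψ, ψ) < ∞}`. -/
def formDomain (h : ℂ → ℝ) : Submodule ℂ Spinor where
  carrier := {ψ | HasFiniteEnergy Complex.I h (up ψ) ∧ HasFiniteEnergy (-Complex.I) (-h) (down ψ)}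
  add_mem' {ψ ξ} hψ hξ :=
    ⟨(hψ.1.add hξ.1).congr (up_add ψ ξ).symm, (hψ.2.add hξ.2).congr (down_add ψ ξ).symm⟩
  zero_mem' := ⟨hasFiniteEnergy_zero.congr up_zero.symm, hasFiniteEnergy_zero.congr down_zero.symm⟩
  smul_mem' a ψ hψ :=
    ⟨(hψ.1.smul a).congr (up_smul a ψ).symm, (hψ.2.smul a).congr (down_smul a ψ).symm⟩

theorem pauliForm_add {h : ℂ → ℝ} {ψ ψ' ξ : Spinor} (hψ : ψ ∈ formDomain h)
    (hψ' : ψ' ∈ formDomain h) (hξ : ξ ∈ formDomain h) :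
    pauliForm h (ψ + ψ') ξ = pauliForm h ψ ξ + pauliForm h ψ' ξ := by
  simp only [pauliForm]
  rw [componentForm_add hψ.1 hψ'.1 hξ.1 (up_add ψ ψ'),
    componentForm_add hψ.2 hψ'.2 hξ.2 (down_add ψ ψ')]
  ring

theorem pauliForm_smul {h : ℂ → ℝ} (a : ℂ) {ψ ξ : Spinor} (hψ : ψ ∈ formDomain h) :
    pauliForm h (a • ψ) ξ = conj a * pauliForm h ψ ξ := by
  simp only [pauliForm]
  rw [componentForm_smul a hψ.1 (up_smul a ψ), componentForm_smul a hψ.2 (down_smul a ψ)]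
  ring

/-- The graph of the operator of the form `π^h`: the pairs `(ψ, η)` with `ψ ∈ D(π^h)` and
`(η, ξ) = π^h(ψ, ξ)` for all `ξ ∈ D(π^h)`. The vector `η` is taken in the closure of `D(π^h)`,
which makes it unique; this is no restriction when `D(π^h)` is dense. -/
def pauliGraph (h : ℂ → ℝ) : Submodule ℂ (Spinor × Spinor) where
  carrier := {p | p.1 ∈ formDomain h ∧ p.2 ∈ (formDomain h).topologicalClosure ∧
    ∀ ξ ∈ formDomain h, inner ℂ p.2 ξ = pauliForm h p.1 ξ}
  add_mem' {p q} hp hq := ⟨add_mem hp.1 hq.1, add_mem hp.2.1 hq.2.1, fun ξ hξ => by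
    rw [Prod.snd_add, Prod.fst_add, inner_add_left, pauliForm_add hp.1 hq.1 hξ,
      hp.2.2 ξ hξ, hq.2.2 ξ hξ]⟩
  zero_mem' := ⟨zero_mem _, zero_mem _, fun ξ hξ => by
    have h0 := pauliForm_smul (h := h) (ξ := ξ) 0 (zero_mem (formDomain h))
    rw [zero_smul, map_zero, zero_mul] at h0
    rw [Prod.fst_zero, Prod.snd_zero, inner_zero_left, h0]⟩
  smul_mem' a p hp := ⟨Submodule.smul_mem _ a hp.1, Submodule.smul_mem _ a hp.2.1, fun ξ hξ => by
    rw [Prod.smul_fst, Prod.smul_snd, inner_smul_left, pauliForm_smul a hp.1, hp.2.2 ξ hξ]⟩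

theorem pauliGraph_single_valued (h : ℂ → ℝ) (p : Spinor × Spinor) (hp : p ∈ pauliGraph h)
    (h0 : p.1 = 0) : p.2 = 0 := by
  have h1 : p.2 ∈ (formDomain h)ᗮ := by
    rw [Submodule.mem_orthogonal']
    intro ξ hξ
    have h2 := pauliForm_smul (h := h) (ξ := ξ) 0 (zero_mem (formDomain h))
    rw [zero_smul, map_zero, zero_mul] at h2
    rw [hp.2.2 ξ hξ, h0, h2]
  rw [← Submodule.orthogonal_closure] at h1
  exact inner_self_eq_zero.mp (h1 p.2 hp.2.1)

/-- The Pauli operator `H_h` with generating potential `h`, an unbounded operator on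
`L²(ℝ², ℂ²)`: the operator of the form `π^h` on its maximal domain. -/
def pauliOperator (h : ℂ → ℝ) : Spinor →ₗ.[ℂ] Spinor := (pauliGraph h).toLinearPMap

theorem pauliOperator_graph (h : ℂ → ℝ) : (pauliOperator h).graph = pauliGraph h :=
  Submodule.toLinearPMap_graph_eq _ (pauliGraph_single_valued h)

/-- The kernel of the Pauli operator, as a subspace of its domain. -/
def pauliKernel (h : ℂ → ℝ) : Submodule ℂ (pauliOperator h).domain :=
  LinearMap.ker (pauliOperator h).toFun

/-- The largest integer strictly below `x`, for real `x > 0`, and `0` for `x = 0`. -/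
def strictFloor (x : ℝ) : ℕ := ⌈x⌉₊ - 1

end Pauli

end

/-!
The field is `B = Δ h₀` for the potential `h₀ = log (1 + |z|²) + x² arctan x`. The second summand is
odd in `x`, so its Laplacian has no flux through discs centred at the origin, while the first one has
total flux `2` (`tendsto_flux_baseField`). At infinity, however, `h₀` is of size `x²` with opposite
signs in the two half-planes, and this rules out zero modes.

If `ψ` is in the kernel of `H_h`, then `e^{-h} ψ₊` and the conjugate of `e^h ψ₋` are weak solutions
of the Cauchy-Riemann equation, hence entire functions by Weyl's lemma
(`exists_differentiable_ae_eq`). By Weyl's lemma for the Laplace operator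
(`exists_harmonic_ae_eq`) any generating potential is `h = h₀ + Re F` with `F` entire
(`exists_entire_of_isGeneratingPotential`), and the factor `e^{± F}` can be absorbed into the entire
functions. After the reflection `z ↦ -z` in the spin-down case, both components lead to an entire
function `k` with `∫ |k|² (1 + |z|²)⁻² e^{2 x² arctan x} < ∞`. Such a `k` grows at most polynomially
in the right half-plane and is `O((1 + x)² e^{-(x - 1)² / 2})` on the positive half-line, so that it
vanishes by the Phragmén–Lindelöf principle (`eq_zero_of_integrable_weight`).

Both forms of Weyl's lemma rest on `ae_eq_convolution_radialMollifier`: the regularisations of a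
weak solution are classical solutions, have the mean value property, and are thus fixed by
convolution with a radial mollifier; in the limit, so is the weak solution.
-/

/-! ### Convolution and differentiation -/

open ContinuousLinearMap in
theorem fderiv_convolution_lsmul_apply {E : Type*} [NormedAddCommGroup E] [NormedSpace ℝ E]
    {η : ℂ → ℝ} {u : ℂ → E} (hc : HasCompactSupport η) (hη : ContDiff ℝ 1 η)
    (hu : LocallyIntegrable u volume) (x v : ℂ) :
    fderiv ℝ (convolution η u (lsmul ℝ ℝ) volume) x v =
      convolution (fun y => fderiv ℝ η y v) u (lsmul ℝ ℝ) volume x := by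
  rw [(hc.hasFDerivAt_convolution_left (lsmul ℝ ℝ) hη hu x).fderiv]
  have h1 : ConvolutionExistsAt (fderiv ℝ η) u x ((lsmul ℝ ℝ).precompL ℂ) volume :=
    (hc.fderiv ℝ).convolutionExists_left _ (hη.continuous_fderiv one_ne_zero) hu x
  rw [convolution_def, ContinuousLinearMap.integral_apply h1]
  rfl

theorem laplacian_eq_fderiv_fderiv {F : Type*} [NormedAddCommGroup F] [NormedSpace ℝ F]
    {f : ℂ → F} (hf : ContDiff ℝ 2 f) (x : ℂ) :
    Laplacian.laplacian f x = fderiv ℝ (fun y => fderiv ℝ f y 1) x 1 +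
      fderiv ℝ (fun y => fderiv ℝ f y Complex.I) x Complex.I := by
  have h1 : DifferentiableAt ℝ (fderiv ℝ f) x :=
    ((hf.fderiv_right (m := 1) (by norm_num)).differentiable one_ne_zero) x
  have h2 (v : ℂ) : fderiv ℝ (fun y => fderiv ℝ f y v) x v = fderiv ℝ (fderiv ℝ f) x v v := by
    rw [fderiv_clm_apply h1 (by fun_prop)]
    simp
  rw [h2, h2, InnerProductSpace.laplacian_eq_iteratedFDeriv_complexPlane]
  simp [iteratedFDeriv_two_apply]

theorem contDiff_fderiv_apply {F : Type*} [NormedAddCommGroup F] [NormedSpace ℝ F] {f : ℂ → F}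
    (hf : ContDiff ℝ ∞ f) (v : ℂ) : ContDiff ℝ ∞ (fun y => fderiv ℝ f y v) :=
  (hf.fderiv_right (m := ∞) (by simp)).clm_apply contDiff_const

open ContinuousLinearMap in
theorem laplacian_convolution_lsmul {E : Type*} [NormedAddCommGroup E] [NormedSpace ℝ E]
    {η : ℂ → ℝ} {u : ℂ → E} (hc : HasCompactSupport η) (hη : ContDiff ℝ ∞ η)
    (hu : LocallyIntegrable u volume) (x : ℂ) :
    Laplacian.laplacian (convolution η u (lsmul ℝ ℝ) volume) x =
      convolution (Laplacian.laplacian η) u (lsmul ℝ ℝ) volume x := by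
  have h1 : ContDiff ℝ ∞ (convolution η u (lsmul ℝ ℝ) volume) :=
    hc.contDiff_convolution_left _ hη hu
  have h2 (v : ℂ) : HasCompactSupport (fun y => fderiv ℝ η y v) := hc.fderiv_apply ℝ v
  have h3 (v : ℂ) := contDiff_fderiv_apply hη v
  have h4 (v : ℂ) : (fun y => fderiv ℝ (convolution η u (lsmul ℝ ℝ) volume) y v) =
      convolution (fun y => fderiv ℝ η y v) u (lsmul ℝ ℝ) volume :=
    funext fun y => fderiv_convolution_lsmul_apply hc (hη.of_le (by simp)) hu y v
  rw [laplacian_eq_fderiv_fderiv (contDiff_infty.1 h1 2), h4, h4,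
    fderiv_convolution_lsmul_apply (h2 _) ((h3 _).of_le (by simp)) hu,
    fderiv_convolution_lsmul_apply (h2 _) ((h3 _).of_le (by simp)) hu]
  have h5 (v : ℂ) : ConvolutionExistsAt (fun y => fderiv ℝ (fun y => fderiv ℝ η y v) y v) u x
      (lsmul ℝ ℝ) volume :=
    ((h2 v).fderiv_apply ℝ v).convolutionExists_left _
      (contDiff_fderiv_apply (h3 v) v).continuous hu x
  rw [show Laplacian.laplacian η = (fun y => fderiv ℝ (fun y => fderiv ℝ η y 1) y 1) +
    (fun y => fderiv ℝ (fun y => fderiv ℝ η y Complex.I) y Complex.I) from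
      funext (laplacian_eq_fderiv_fderiv (contDiff_infty.1 hη 2))]
  exact ((h5 1).add_distrib (h5 Complex.I)).symm

/-! ### The mean value property and radial mollification -/

/-- Integration in polar coordinates: a radial weight only sees the mean value of `f` over the
circles centred at `c`. -/
theorem integral_radial_smul_of_circleAverage_eq {E : Type*} [NormedAddCommGroup E]
    [NormedSpace ℝ E] [CompleteSpace E] {f : ℂ → E} (hf : Continuous f) {c : ℂ}
    (hm : ∀ R : ℝ, Real.circleAverage f c R = f c) {χ : ℝ → ℝ} (hχ : Continuous χ)
    (hs : ∀ r, 1 ≤ r → χ r = 0) :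
    ∫ w, χ ‖w‖ • f (c + w) = (∫ r in Ioi (0 : ℝ), 2 * Real.pi * r * χ r) • f c := by
  let G : ℝ × ℝ → E := fun p => (p.1 * χ p.1) • f (circleMap c p.1 p.2)
  have hG : Continuous G := by
    simp only [G, circleMap]
    fun_prop
  have hI : IntegrableOn G (Ioi (0 : ℝ) ×ˢ Ioo (-Real.pi) Real.pi) := by
    have h1 : IntegrableOn G (Icc (0 : ℝ) 1 ×ˢ Icc (-Real.pi) Real.pi) :=
      hG.continuousOn.integrableOn_compact (isCompact_Icc.prod isCompact_Icc)
    refine h1.of_forall_sdiff_eq_zero (measurableSet_Ioi.prod measurableSet_Ioo) fun p hp => ?_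
    have h2 : 1 ≤ p.1 := by
      by_contra! h3
      exact hp.2 ⟨⟨hp.1.1.le, h3.le⟩, ⟨hp.1.2.1.le, hp.1.2.2.le⟩⟩
    simp [G, hs _ h2]
  rw [← Complex.integral_comp_polarCoord_symm, polarCoord_target]
  have h3 : ∫ p in Ioi (0 : ℝ) ×ˢ Ioo (-Real.pi) Real.pi, p.1 • χ ‖Complex.polarCoord.symm p‖ •
      f (c + Complex.polarCoord.symm p) = ∫ p in Ioi (0 : ℝ) ×ˢ Ioo (-Real.pi) Real.pi, G p := by
    refine setIntegral_congr_fun (measurableSet_Ioi.prod measurableSet_Ioo) fun p hp => ?_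
    have h4 : ‖Complex.polarCoord.symm p‖ = p.1 := by
      rw [Complex.norm_polarCoord_symm, abs_of_pos hp.1]
    have h5 : c + Complex.polarCoord.symm p = circleMap c p.1 p.2 := by
      rw [Complex.polarCoord_symm_apply, circleMap, Complex.exp_mul_I]
      simp
    simp only [h4, h5, G, smul_smul]
  rw [h3, Measure.volume_eq_prod, setIntegral_prod _ hI, ← integral_smul_const]
  refine setIntegral_congr_fun measurableSet_Ioi fun r _ => ?_
  simp only [G]
  rw [integral_smul, ← integral_Ioc_eq_integral_Ioo,
    ← intervalIntegral.integral_of_le (by linarith [Real.pi_pos])]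
  have h6 := hm r
  rw [Real.circleAverage_eq_integral_add (-Real.pi)] at h6
  have h7 : ∫ θ in (0 : ℝ)..2 * Real.pi, f (circleMap c r (θ + -Real.pi)) =
      ∫ θ in (-Real.pi)..Real.pi, f (circleMap c r θ) := by
    rw [intervalIntegral.integral_comp_add_right (fun θ => f (circleMap c r θ))]
    congr 1 <;> ring
  rw [h7] at h6
  rw [← h6, smul_smul]
  congr 1
  field_simp

/-- A smooth radial cut-off supported in the closed unit disc. -/
noncomputable def radialBump (z : ℂ) : ℝ := Real.smoothTransition (1 - ‖z‖ ^ 2)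

theorem contDiff_radialBump : ContDiff ℝ ∞ radialBump :=
  Real.smoothTransition.contDiff.comp (contDiff_const.sub (contDiff_norm_sq ℝ))

theorem radialBump_nonneg (z : ℂ) : 0 ≤ radialBump z := Real.smoothTransition.nonneg _

theorem radialBump_eq_zero {z : ℂ} (hz : 1 ≤ ‖z‖) : radialBump z = 0 :=
  Real.smoothTransition.zero_of_nonpos (by nlinarith)

theorem hasCompactSupport_radialBump : HasCompactSupport radialBump := by
  refine HasCompactSupport.intro (isCompact_closedBall (0 : ℂ) 1) fun z hz => ?_
  rw [mem_closedBall_zero_iff, not_le] at hz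
  exact radialBump_eq_zero hz.le

theorem integral_radialBump_pos : 0 < ∫ z, radialBump z := by
  refine (contDiff_radialBump.continuous).integral_pos_of_hasCompactSupport_nonneg_nonzero
    hasCompactSupport_radialBump radialBump_nonneg (x := 0) ?_
  simp [radialBump]

/-- The radial cut-off normalised to have integral one. -/
noncomputable def radialMollifier (z : ℂ) : ℝ := (∫ w, radialBump w)⁻¹ * radialBump z

theorem contDiff_radialMollifier : ContDiff ℝ ∞ radialMollifier :=
  contDiff_const.mul contDiff_radialBump

theorem hasCompactSupport_radialMollifier : HasCompactSupport radialMollifier :=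
  hasCompactSupport_radialBump.mul_left

open ContinuousLinearMap in
/-- A continuous function with the mean value property is invariant under radial mollification. -/
theorem convolution_radialMollifier_eq_self {E : Type*} [NormedAddCommGroup E]
    [NormedSpace ℝ E] [CompleteSpace E] {f : ℂ → E} (hf : Continuous f) {c : ℂ}
    (hm : ∀ R : ℝ, Real.circleAverage f c R = f c) :
    convolution radialMollifier f (lsmul ℝ ℝ) volume c = f c := by
  set χ : ℝ → ℝ := fun r => Real.smoothTransition (1 - r ^ 2) with hχ_def
  have hχ : Continuous χ := by
    have := Real.smoothTransition.continuous
    fun_prop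
  have hs (r : ℝ) (hr : 1 ≤ r) : χ r = 0 := Real.smoothTransition.zero_of_nonpos (by nlinarith)
  have h1 := integral_radial_smul_of_circleAverage_eq hf hm hχ hs
  have h2 := integral_radial_smul_of_circleAverage_eq (f := fun _ : ℂ => (1 : ℝ)) (c := 0)
    continuous_const (by simp [Real.circleAverage_const]) hχ hs
  simp only [smul_eq_mul, mul_one] at h2
  rw [← h2] at h1
  -- The convolution evaluates `f` at `c - w`; the weight is even.
  have h3 : ∫ w, χ ‖w‖ • f (c + w) = ∫ w, radialBump w • f (c - w) := by
    rw [← integral_neg_eq_self]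
    simp [χ, radialBump, sub_eq_add_neg]
  rw [h3] at h1
  simp only [convolution_def, lsmul_apply, radialMollifier]
  simp only [mul_smul]
  rw [integral_smul, h1, smul_smul]
  change ((∫ w, radialBump w)⁻¹ * ∫ w, radialBump w) • f c = f c
  rw [inv_mul_cancel₀ integral_radialBump_pos.ne', one_smul]

/-! ### Weyl's lemma -/

open ContinuousLinearMap in
/-- If all regularisations of `u` have the mean value property, then `u` agrees almost everywhere
with its radial mollification, hence is smooth. Indeed `η_n ⋆ u` is invariant under the radial
mollifier `ρ`, so that `η_n ⋆ u = η_n ⋆ (ρ ⋆ u)`, and both sides converge as `η_n` shrinks. -/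
theorem ae_eq_convolution_radialMollifier {E : Type*} [NormedAddCommGroup E] [NormedSpace ℝ E]
    [CompleteSpace E] {u : ℂ → E} (hu : LocallyIntegrable u volume)
    (hm : ∀ η : ℂ → ℝ, ContDiff ℝ ∞ η → HasCompactSupport η → ∀ (c : ℂ) (R : ℝ),
      Real.circleAverage (convolution η u (lsmul ℝ ℝ) volume) c R =
        convolution η u (lsmul ℝ ℝ) volume c) :
    u =ᵐ[volume] convolution radialMollifier u (lsmul ℝ ℝ) volume := by
  -- Almost everywhere convergence needs a bounded ratio of the outer and inner radii.
  let φ : ℕ → ContDiffBump (0 : ℂ) := fun n =>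
    ⟨1 / (n + 1), 2 * (1 / (n + 1)), by positivity, by
      have : (0 : ℝ) < 1 / (n + 1) := by positivity
      linarith⟩
  have hφ : Tendsto (fun n => (φ n).rOut) atTop (𝓝 0) := by
    simpa only [mul_zero] using (tendsto_one_div_add_atTop_nhds_zero_nat (𝕜 := ℝ)).const_mul 2
  have hρ := contDiff_radialMollifier
  have hρc := hasCompactSupport_radialMollifier
  have hun : LocallyIntegrable (fun x => ‖u x‖) volume := fun x => (hu x).norm
  have hcont {η : ℂ → ℝ} (hη : Continuous η) (hc : HasCompactSupport η) :
      Continuous (convolution η u (lsmul ℝ ℝ) volume) := hc.continuous_convolution_left _ hη hu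
  have hassoc {η ζ : ℂ → ℝ} (hη : Continuous η) (hηc : HasCompactSupport η) (hζ : Continuous ζ)
      (hζc : HasCompactSupport ζ) (x : ℂ) :
      convolution (convolution η ζ (lsmul ℝ ℝ) volume) u (lsmul ℝ ℝ) volume x =
        convolution η (convolution ζ u (lsmul ℝ ℝ) volume) (lsmul ℝ ℝ) volume x := by
    refine convolution_assoc (lsmul ℝ ℝ) (lsmul ℝ ℝ) (lsmul ℝ ℝ) (lsmul ℝ ℝ)
      (fun a b e => mul_smul a b e) hη.aestronglyMeasurable hζ.aestronglyMeasurable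
      hu.aestronglyMeasurable ?_ ?_ ?_
    · exact .of_forall fun y => hηc.convolutionExists_left _ hη hζ.locallyIntegrable y
    · exact .of_forall fun y => hζc.norm.convolutionExists_left _ hζ.norm hun y
    · refine hηc.norm.convolutionExists_left _ hη.norm ?_ x
      exact (hζc.norm.continuous_convolution_left _ hζ.norm hun).locallyIntegrable
  filter_upwards [ContDiffBump.ae_convolution_tendsto_right_of_locallyIntegrable (K := 2) hφ
    (.of_forall fun n => le_rfl) hu] with x hx
  refine tendsto_nhds_unique hx ?_
  have hlim := ContDiffBump.convolution_tendsto_right_of_continuous (μ := volume) hφ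
    (hcont hρ.continuous hρc) x
  refine hlim.congr fun n => ?_
  have h1 : Continuous ((φ n).normed volume) := (φ n).continuous_normed
  have h2 : HasCompactSupport ((φ n).normed volume) := (φ n).hasCompactSupport_normed
  have h3 : convolution ((φ n).normed volume) radialMollifier (lsmul ℝ ℝ) volume =
      convolution radialMollifier ((φ n).normed volume) (lsmul ℝ ℝ) volume := by
    rw [← convolution_flip]
    congr 1
    ext
    simp
  rw [← hassoc h1 h2 hρ.continuous hρc, h3, hassoc hρ.continuous hρc h1 h2]
  exact convolution_radialMollifier_eq_self (hcont h1 h2)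
    (hm _ (φ n).contDiff_normed h2 x)

open ContinuousLinearMap in
/-- **Weyl's lemma** for the Laplace operator in the plane. -/
theorem exists_harmonic_ae_eq {u : ℂ → ℝ} (hu : LocallyIntegrable u volume)
    (hw : ∀ φ : ℂ → ℝ, ContDiff ℝ ∞ φ → HasCompactSupport φ →
      ∫ z, u z * Laplacian.laplacian φ z = 0) :
    ∃ v : ℂ → ℝ, InnerProductSpace.HarmonicOnNhd v univ ∧ u =ᵐ[volume] v := by
  have key (η : ℂ → ℝ) (hη : ContDiff ℝ ∞ η) (hc : HasCompactSupport η) :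
      InnerProductSpace.HarmonicOnNhd (convolution η u (lsmul ℝ ℝ) volume) univ := by
    have h1 : ContDiff ℝ ∞ (convolution η u (lsmul ℝ ℝ) volume) :=
      hc.contDiff_convolution_left _ hη hu
    refine fun x _ => ⟨(contDiff_infty.1 h1 2).contDiffAt, .of_forall fun y => ?_⟩
    rw [laplacian_convolution_lsmul hc hη hu, convolution_eq_swap]
    -- The Laplacian of the convolution at `y` is the left side of the weak equation tested on
    -- `t ↦ η (y - t)`.
    have h2 := hw (fun t => η (y - t)) (hη.comp (contDiff_const.sub contDiff_id))
      (hc.comp_homeomorph (Homeomorph.subLeft y))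
    have hη2 := contDiff_infty.1 hη 2
    have h3 (t : ℂ) : Laplacian.laplacian (fun t => η (y - t)) t =
        Laplacian.laplacian η (y - t) := by
      have h4 (g : ℂ → ℝ) (v s : ℂ) (hg : Differentiable ℝ g) :
          fderiv ℝ (fun t => g (y - t)) s v = - fderiv ℝ g (y - s) v := by
        have h5 : HasFDerivAt (fun t : ℂ => y - t) (-ContinuousLinearMap.id ℝ ℂ) s :=
          (hasFDerivAt_id s).const_sub y
        rw [HasFDerivAt.fderiv (f := fun t => g (y - t)) ((hg (y - s)).hasFDerivAt.comp s h5)]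
        simp
      have h6 (v : ℂ) : fderiv ℝ (fun t => fderiv ℝ (fun t => η (y - t)) t v) t v =
          fderiv ℝ (fun t => fderiv ℝ η t v) (y - t) v := by
        have h7 : (fun t => fderiv ℝ (fun t => η (y - t)) t v) =
            fun t => - fderiv ℝ η (y - t) v :=
          funext fun s => h4 η v s (hη.differentiable (by simp))
        rw [h7, fderiv_fun_neg, neg_apply, h4 (fun t => fderiv ℝ η t v) v t
          ((contDiff_fderiv_apply hη v).differentiable (by simp)), neg_neg]
      rw [laplacian_eq_fderiv_fderiv hη2, laplacian_eq_fderiv_fderiv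
        (f := fun t => η (y - t)) (hη2.comp (contDiff_const.sub contDiff_id)), h6, h6]
    simp only [h3] at h2
    simpa [mul_comm] using h2
  exact ⟨_, key _ contDiff_radialMollifier hasCompactSupport_radialMollifier,
    ae_eq_convolution_radialMollifier hu fun η hη hc c R =>
      InnerProductSpace.HarmonicOnNhd.circleAverage_eq ((key η hη hc).mono (subset_univ _))⟩

open ContinuousLinearMap in
/-- **Weyl's lemma** for the Cauchy-Riemann operator. -/
theorem exists_differentiable_ae_eq {f : ℂ → ℂ} (hf : Pauli.IsWeakWirtinger Complex.I f 0) :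
    ∃ g : ℂ → ℂ, Differentiable ℂ g ∧ f =ᵐ[volume] g := by
  have hu := hf.left
  have key (η : ℂ → ℝ) (hη : ContDiff ℝ ∞ η) (hc : HasCompactSupport η) :
      Differentiable ℂ (convolution η f (lsmul ℝ ℝ) volume) := by
    have h1 : ContDiff ℝ ∞ (convolution η f (lsmul ℝ ℝ) volume) :=
      hc.contDiff_convolution_left _ hη hu
    intro y
    refine differentiableAt_complex_iff_differentiableAt_real.2
      ⟨h1.differentiable (by simp) y, ?_⟩
    have hη1 : ContDiff ℝ 1 η := contDiff_infty.1 hη 1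
    have hφ : Pauli.IsTestFunction (fun t => (η (y - t) : ℂ)) :=
      ⟨Complex.ofRealCLM.contDiff.comp (hη.comp (contDiff_const.sub contDiff_id)),
        (hc.comp_homeomorph (Homeomorph.subLeft y)).comp_left (g := Complex.ofReal) rfl⟩
    have h2 := hf.integral_eq _ hφ
    have h3 (v t : ℂ) : fderiv ℝ (fun t => (η (y - t) : ℂ)) t v =
        -((fderiv ℝ η (y - t) v : ℝ) : ℂ) := by
      have h5 : HasFDerivAt (fun t : ℂ => y - t) (-ContinuousLinearMap.id ℝ ℂ) t :=
        (hasFDerivAt_id t).const_sub y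
      have h6 := Complex.ofRealCLM.hasFDerivAt.comp t
        ((hη.differentiable (by simp) (y - t)).hasFDerivAt.comp t h5)
      have h7 := h6.fderiv
      simp only [Function.comp_def, Complex.ofRealCLM_apply] at h7
      rw [h7]
      simp
    have h8 (v : ℂ) : Integrable (fun t => ((fderiv ℝ η (y - t) v : ℝ) : ℂ) * f t) volume := by
      have h9 : Continuous (fun t => ((fderiv ℝ η (y - t) v : ℝ) : ℂ)) := by
        have := (contDiff_fderiv_apply hη v).continuous
        fun_prop
      have h10 : HasCompactSupport (fun t => ((fderiv ℝ η (y - t) v : ℝ) : ℂ)) :=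
        ((hc.fderiv_apply ℝ v).comp_homeomorph (Homeomorph.subLeft y)).comp_left
          (g := Complex.ofReal) rfl
      simpa only [mul_comm] using Pauli.integrable_mul_test hu h9 h10
    have h11 (v : ℂ) : fderiv ℝ (convolution η f (lsmul ℝ ℝ) volume) y v =
        ∫ t, ((fderiv ℝ η (y - t) v : ℝ) : ℂ) * f t := by
      rw [fderiv_convolution_lsmul_apply hc hη1 hu, convolution_eq_swap]
      simp
    have h12 : ∫ t, f t * Pauli.wirtinger Complex.I (fun t => (η (y - t) : ℂ)) t =
        -(1 / 2) * ((∫ t, ((fderiv ℝ η (y - t) 1 : ℝ) : ℂ) * f t) +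
          Complex.I * ∫ t, ((fderiv ℝ η (y - t) Complex.I : ℝ) : ℂ) * f t) := by
      rw [← integral_const_mul, ← integral_add (h8 _) ((h8 _).const_mul _), ← integral_const_mul]
      refine integral_congr_ae (.of_forall fun t => ?_)
      simp only [Pauli.wirtinger, h3]
      ring
    rw [h12, ← h11, ← h11] at h2
    simp only [Pi.zero_apply, zero_mul, integral_zero, neg_zero] at h2
    have h13 := (mul_eq_zero.1 h2).resolve_left (by norm_num)
    rw [smul_eq_mul]
    linear_combination (-Complex.I) * h13 + (fderiv ℝ (convolution η f (lsmul ℝ ℝ) volume) y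
      Complex.I) * Complex.I_mul_I
  exact ⟨_, key _ contDiff_radialMollifier hasCompactSupport_radialMollifier,
    ae_eq_convolution_radialMollifier hu fun η hη hc c R =>
      DiffContOnCl.circleAverage (key η hη hc).diffContOnCl⟩

/-! ### Entire functions that are square integrable against a decaying weight -/

/-- The profile `x ↦ x² arctan x` of the odd part of the potential. -/
noncomputable def oddProfile (x : ℝ) : ℝ := x ^ 2 * Real.arctan x

theorem oddProfile_neg (x : ℝ) : oddProfile (-x) = -oddProfile x := by
  simp [oddProfile, Real.arctan_neg]

theorem hasDerivAt_oddProfile (x : ℝ) :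
    HasDerivAt oddProfile (2 * x * Real.arctan x + x ^ 2 / (1 + x ^ 2)) x := by
  have h := (hasDerivAt_pow 2 x).mul (Real.hasDerivAt_arctan x)
  refine h.congr_deriv ?_
  simp
  ring

theorem monotone_oddProfile : Monotone oddProfile := by
  refine monotone_of_hasDerivAt_nonneg hasDerivAt_oddProfile fun x => ?_
  have h1 : 0 ≤ x * Real.arctan x := by
    rcases le_total 0 x with h | h
    · exact mul_nonneg h (Real.arctan_nonneg.2 h)
    · exact mul_nonneg_of_nonpos_of_nonpos h (Real.arctan_le_zero.2 h)
  have h2 : 0 ≤ x ^ 2 / (1 + x ^ 2) := by positivity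
  simp only [Pi.zero_apply]
  linarith

theorem half_sq_le_oddProfile {x : ℝ} (hx : 1 ≤ x) : x ^ 2 / 2 ≤ oddProfile x := by
  have h1 : Real.arctan 1 ≤ Real.arctan x := Real.arctan_strictMono.monotone hx
  rw [Real.arctan_one] at h1
  have h2 : (1 : ℝ) / 2 ≤ Real.arctan x := by linarith [Real.pi_gt_three]
  unfold oddProfile
  nlinarith [sq_nonneg x]

theorem neg_one_le_oddProfile {x : ℝ} (hx : -1 ≤ x) : -1 ≤ oddProfile x := by
  refine le_trans ?_ (monotone_oddProfile hx)
  rw [oddProfile_neg, oddProfile, Real.arctan_one]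
  linarith [Real.pi_lt_four]

/-- Mean values over unit discs turn a weighted `L²` bound into a pointwise bound. -/
theorem exists_norm_sq_le_of_integrable {k : ℂ → ℂ} (hk : Differentiable ℂ k)
    (hint : Integrable (fun z => ‖k z‖ ^ 2 * ((1 + ‖z‖ ^ 2) ^ 2)⁻¹ *
      Real.exp (2 * oddProfile z.re)) volume) :
    ∃ A, 0 ≤ A ∧ ∀ z, ‖k z‖ ^ 2 ≤
      A * ((1 + (‖z‖ + 1) ^ 2) ^ 2 * Real.exp (-(2 * oddProfile (z.re - 1)))) := by
  set W : ℂ → ℝ := fun z => ‖k z‖ ^ 2 * ((1 + ‖z‖ ^ 2) ^ 2)⁻¹ * Real.exp (2 * oddProfile z.re)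
  have hW0 (z : ℂ) : 0 ≤ W z := by positivity
  have hS0 : 0 ≤ (∫ w, radialBump w)⁻¹ := inv_nonneg.2 integral_radialBump_pos.le
  refine ⟨(∫ w, radialBump w)⁻¹ * ∫ w, W w, mul_nonneg hS0 (integral_nonneg hW0), fun z => ?_⟩
  have h1 : Differentiable ℂ (fun z => k z ^ 2) := hk.pow 2
  have h2 := convolution_radialMollifier_eq_self h1.continuous
    (fun R => DiffContOnCl.circleAverage (R := R) (c := z) h1.diffContOnCl)
  rw [convolution_def] at h2
  rw [← norm_pow, ← h2]
  set D := (1 + (‖z‖ + 1) ^ 2) ^ 2 * Real.exp (-(2 * oddProfile (z.re - 1)))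
  have hWi : Integrable (fun t => (∫ w, radialBump w)⁻¹ * D * W (z - t)) volume :=
    (hint.comp_sub_left z).const_mul _
  refine (norm_integral_le_of_norm_le hWi (.of_forall fun t => ?_)).trans_eq ?_
  · rcases le_or_gt 1 ‖t‖ with ht | ht
    · have : radialMollifier t = 0 := by simp [radialMollifier, radialBump_eq_zero ht]
      rw [this]
      simp only [map_zero, zero_apply, norm_zero]
      have := hW0 (z - t)
      positivity
    · have h3 : |t.re| ≤ 1 := (Complex.abs_re_le_norm t).trans ht.le
      have h4 : ‖z - t‖ ≤ ‖z‖ + 1 := (norm_sub_le z t).trans (by linarith)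
      have h5 : oddProfile (z.re - 1) ≤ oddProfile (z - t).re :=
        monotone_oddProfile (by rw [Complex.sub_re]; linarith [(abs_le.1 h3).2])
      have h6 : ‖k (z - t)‖ ^ 2 = (1 + ‖z - t‖ ^ 2) ^ 2 *
          Real.exp (-(2 * oddProfile (z - t).re)) * W (z - t) := by
        simp only [W]
        rw [Real.exp_neg]
        field_simp
      have h7 : ‖k (z - t)‖ ^ 2 ≤ D * W (z - t) := by
        rw [h6]
        simp only [D]
        have := hW0 (z - t)
        gcongr
      have h8 : radialMollifier t ≤ (∫ w, radialBump w)⁻¹ :=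
        mul_le_of_le_one_right hS0 (Real.smoothTransition.le_one _)
      have h9 : 0 ≤ radialMollifier t := mul_nonneg hS0 (radialBump_nonneg t)
      rw [ContinuousLinearMap.lsmul_apply, norm_smul, norm_pow, Real.norm_of_nonneg h9, mul_assoc]
      exact mul_le_mul h8 h7 (by positivity) hS0
  · rw [integral_const_mul, integral_sub_left_eq_self W]
    ring

/-- The weight forces `k / (1 + z)²` to be bounded on the right half-plane and superexponentially
small on the positive half-line, so that the Phragmén–Lindelöf principle applies. -/
theorem eq_zero_of_integrable_weight {k : ℂ → ℂ} (hk : Differentiable ℂ k)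
    (hint : Integrable (fun z => ‖k z‖ ^ 2 * ((1 + ‖z‖ ^ 2) ^ 2)⁻¹ *
      Real.exp (2 * oddProfile z.re)) volume) : k = 0 := by
  obtain ⟨A, hA, hbound⟩ := exists_norm_sq_le_of_integrable hk hint
  set F : ℂ → ℂ := fun z => k z / (1 + z) ^ 2
  have hne {z : ℂ} (hz : 0 ≤ z.re) : 1 + z ≠ 0 := by
    intro h
    have := congrArg Complex.re h
    simp at this
    linarith
  have hF {z : ℂ} (hz : 0 ≤ z.re) : ‖F z‖ ≤ 3 * √A * Real.exp (-oddProfile (z.re - 1)) := by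
    have h1 : 1 + ‖z‖ ^ 2 ≤ ‖1 + z‖ ^ 2 := by
      rw [Complex.sq_norm, Complex.sq_norm, Complex.normSq_apply, Complex.normSq_apply]
      simp
      nlinarith
    have h2 : 1 + (‖z‖ + 1) ^ 2 ≤ 3 * ‖1 + z‖ ^ 2 := by nlinarith [sq_nonneg (‖z‖ - 1)]
    have h3 : ‖k z‖ ^ 2 ≤ (3 * √A * Real.exp (-oddProfile (z.re - 1)) * ‖1 + z‖ ^ 2) ^ 2 := by
      refine (hbound z).trans ?_
      have h4 : Real.exp (-(2 * oddProfile (z.re - 1))) =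
          Real.exp (-oddProfile (z.re - 1)) ^ 2 := by
        rw [← Real.exp_nat_mul]
        congr 1
        push_cast
        ring
      rw [h4]
      calc A * ((1 + (‖z‖ + 1) ^ 2) ^ 2 * Real.exp (-oddProfile (z.re - 1)) ^ 2)
          ≤ A * ((3 * ‖1 + z‖ ^ 2) ^ 2 * Real.exp (-oddProfile (z.re - 1)) ^ 2) := by gcongr
        _ = _ := by
          rw [mul_pow, mul_pow, mul_pow, mul_pow, Real.sq_sqrt hA]
          ring
    have h5 := abs_le_of_sq_le_sq h3 (by positivity)
    simp only [F, norm_div, norm_pow]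
    rw [div_le_iff₀ (by have := norm_pos_iff.2 (hne hz); positivity)]
    exact (le_abs_self _).trans h5
  have hF1 {z : ℂ} (hz : 0 ≤ z.re) : ‖F z‖ ≤ 3 * √A * Real.exp 1 := by
    refine (hF hz).trans ?_
    have := neg_one_le_oddProfile (x := z.re - 1) (by linarith)
    gcongr
    linarith
  have hdiff : DiffContOnCl ℂ F {z | 0 < z.re} := by
    refine DifferentiableOn.diffContOnCl fun z hz => ?_
    rw [Complex.closure_setOfPred_lt_re] at hz
    exact ((hk z).div (((differentiableAt_const _).add differentiableAt_id).pow 2)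
      (pow_ne_zero 2 (hne hz))).differentiableWithinAt
  have hzero : EqOn F 0 {z : ℂ | 0 ≤ z.re} := by
    refine PhragmenLindelof.eq_zero_on_right_half_plane_of_superexponential_decay hdiff
      ⟨0, by norm_num, 0, ?_⟩ ?_ ⟨3 * √A * Real.exp 1, fun x => hF1 (by simp)⟩
    · refine Asymptotics.IsBigO.of_bound (3 * √A * Real.exp 1) ?_
      refine eventually_inf_principal.2 (.of_forall fun z hz => ?_)
      simpa using hF1 (le_of_lt hz)
    · intro n
      have hlim : Tendsto (fun x : ℝ => 3 * √A * Real.exp (-x)) atTop (𝓝 0) := by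
        simpa using (Real.tendsto_exp_neg_atTop_nhds_zero.const_mul (3 * √A))
      refine squeeze_zero' (.of_forall fun x => by positivity) ?_ hlim
      -- From `2 n + 4` on, the exponent `(x - 1)² / 2` is at least `(n + 1) x`.
      filter_upwards [eventually_ge_atTop (2 * n + 4 : ℝ)] with x hx
      have hn : (0 : ℝ) ≤ n := n.cast_nonneg
      have h1 := half_sq_le_oddProfile (x := x - 1) (by linarith)
      have h2 : ‖F x‖ ≤ 3 * √A * Real.exp (-oddProfile (x - 1)) := by
        simpa using hF (z := x) (by rw [Complex.ofReal_re]; linarith)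
      calc Real.exp x ^ n * ‖F x‖
          ≤ Real.exp x ^ n * (3 * √A * Real.exp (-oddProfile (x - 1))) := by gcongr
        _ = 3 * √A * Real.exp (n * x - oddProfile (x - 1)) := by
          rw [← Real.exp_nat_mul, sub_eq_add_neg (n * x : ℝ), Real.exp_add]
          ring
        _ ≤ 3 * √A * Real.exp (-x) := by
          gcongr
          nlinarith
  have hev : k =ᶠ[𝓝 1] 0 := by
    have h1 : {z : ℂ | 0 < z.re} ∈ 𝓝 (1 : ℂ) :=
      (isOpen_lt continuous_const Complex.continuous_re).mem_nhds (by simp)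
    filter_upwards [h1] with z hz
    have h2 := hzero (le_of_lt hz : 0 ≤ z.re)
    exact (div_eq_zero_iff.1 h2).resolve_right (pow_ne_zero 2 (hne (le_of_lt hz)))
  have hka : AnalyticOnNhd ℂ k univ := fun z _ => hk.analyticAt z
  have hza : AnalyticOnNhd ℂ (0 : ℂ → ℂ) univ := fun z _ => analyticAt_const
  exact hka.eq_of_eventuallyEq hza hev

/-! ### The magnetic field and its potential -/

/-- The potential `log (1 + |z|²) + x² arctan x`: a radial part, which carries the flux, and a part
that is odd in `x`, carries no flux through centred discs, and grows like `x |x|`. -/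
noncomputable def basePotential (z : ℂ) : ℝ := Real.log (1 + ‖z‖ ^ 2) + oddProfile z.re

/-- The second derivative of `oddProfile`. -/
noncomputable def oddField (x : ℝ) : ℝ :=
  2 * Real.arctan x + 2 * x / (1 + x ^ 2) + 2 * x / (1 + x ^ 2) ^ 2

/-- The Laplacian of `basePotential`. -/
noncomputable def baseField (z : ℂ) : ℝ := 4 / (1 + ‖z‖ ^ 2) ^ 2 + oddField z.re

theorem oddField_neg (x : ℝ) : oddField (-x) = -oddField x := by
  simp only [oddField, Real.arctan_neg, neg_sq]
  ring

theorem continuous_oddField : Continuous oddField := by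
  have h (x : ℝ) : 1 + x ^ 2 ≠ 0 := by positivity
  have h' (x : ℝ) : (1 + x ^ 2) ^ 2 ≠ 0 := pow_ne_zero 2 (h x)
  have := Real.continuous_arctan
  unfold oddField
  fun_prop (disch := assumption)

theorem continuous_radialField : Continuous (fun z : ℂ => 4 / (1 + ‖z‖ ^ 2) ^ 2) := by
  have h (z : ℂ) : (1 + ‖z‖ ^ 2) ^ 2 ≠ 0 := by positivity
  fun_prop (disch := assumption)

theorem continuous_baseField : Continuous baseField :=
  continuous_radialField.add (continuous_oddField.comp Complex.continuous_re)

theorem abs_oddField_le (x : ℝ) : |oddField x| ≤ 8 := by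
  have h0 : (0 : ℝ) < 1 + x ^ 2 := by positivity
  have h1 : |2 * x / (1 + x ^ 2)| ≤ 1 := by
    rw [abs_div, abs_of_pos h0, div_le_one h0, abs_le]
    constructor <;> nlinarith [sq_nonneg (x - 1), sq_nonneg (x + 1)]
  have h2 : |2 * x / (1 + x ^ 2) ^ 2| ≤ 1 := by
    rw [sq (1 + x ^ 2), ← div_div, abs_div, abs_of_pos h0]
    exact div_le_one_of_le₀ (h1.trans (by nlinarith [sq_nonneg x])) h0.le
  have h3 : |2 * Real.arctan x| ≤ 4 := by
    rw [abs_le]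
    constructor <;>
      linarith [Real.arctan_lt_pi_div_two x, Real.neg_pi_div_two_lt_arctan x, Real.pi_lt_four]
  refine (abs_add_three _ _ _).trans ?_
  linarith

theorem abs_baseField_le (z : ℂ) : |baseField z| ≤ 12 := by
  have h1 : |4 / (1 + ‖z‖ ^ 2) ^ 2| ≤ 4 := by
    rw [abs_of_nonneg (by positivity)]
    exact div_le_self (by norm_num) (one_le_pow₀ (by nlinarith [sq_nonneg ‖z‖]))
  refine (abs_add_le _ _).trans ?_
  linarith [abs_oddField_le z.re]

theorem one_le_baseField {z : ℂ} (hz : 1 ≤ z.re) : 1 ≤ baseField z := by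
  have h1 : Real.arctan 1 ≤ Real.arctan z.re := Real.arctan_strictMono.monotone hz
  rw [Real.arctan_one] at h1
  have h2 : 0 ≤ 2 * z.re / (1 + z.re ^ 2) := by positivity
  have h3 : 0 ≤ 2 * z.re / (1 + z.re ^ 2) ^ 2 := by positivity
  have h4 : 0 ≤ 4 / (1 + ‖z‖ ^ 2) ^ 2 := by positivity
  simp only [baseField, oddField]
  linarith [Real.pi_gt_three]

/-- The field is at least `1` on the half-plane `1 ≤ x`, which contains arbitrarily large discs. -/
theorem lintegral_abs_baseField : ∫⁻ z, ENNReal.ofReal |baseField z| = ⊤ := by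
  refine top_le_iff.1 ?_
  have h1 (n : ℕ) : (n : ENNReal) ≤ ∫⁻ z, ENNReal.ofReal |baseField z| := by
    calc (n : ENNReal) ≤ volume (Metric.ball ((n + 1 : ℝ) : ℂ) n) := by
          rw [Complex.volume_ball]
          rcases Nat.eq_zero_or_pos n with rfl | hn
          · simp
          · have h2 : (1 : ENNReal) ≤ n := by exact_mod_cast hn
            have h3 : (1 : ENNReal) ≤ NNReal.pi := by
              have : (1 : NNReal) ≤ NNReal.pi := by
                rw [← NNReal.coe_le_coe]
                simp only [NNReal.coe_one, NNReal.coe_real_pi]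
                linarith [Real.pi_gt_three]
              exact_mod_cast this
            rw [ENNReal.ofReal_natCast, sq, mul_assoc]
            exact le_mul_of_one_le_right' (one_le_mul h2 h3)
      _ = ∫⁻ z in Metric.ball ((n + 1 : ℝ) : ℂ) n, 1 := by simp
      _ ≤ ∫⁻ z in Metric.ball ((n + 1 : ℝ) : ℂ) n, ENNReal.ofReal |baseField z| := by
          refine setLIntegral_mono' measurableSet_ball fun z hz => ?_
          rw [← ENNReal.ofReal_one]
          refine ENNReal.ofReal_le_ofReal (le_trans ?_ (le_abs_self _))
          refine one_le_baseField ?_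
          have h4 := (Complex.abs_re_le_norm (z - ((n + 1 : ℝ) : ℂ))).trans
            (mem_ball_iff_norm.1 hz).le
          rw [Complex.sub_re, Complex.ofReal_re] at h4
          linarith [(abs_le.1 h4).1]
      _ ≤ _ := setLIntegral_le_lintegral _ _
  refine le_of_tendsto' ENNReal.tendsto_nat_nhds_top h1

/-- The odd part of the field has no flux through discs centred at the origin. -/
theorem setIntegral_oddField (r : ℝ) :
    ∫ z in Metric.closedBall (0 : ℂ) r, oddField z.re = 0 := by
  rw [← integral_indicator measurableSet_closedBall]
  have h1 := integral_neg_eq_self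
    ((Metric.closedBall (0 : ℂ) r).indicator fun z => oddField z.re) volume
  have h2 (z : ℂ) : (Metric.closedBall (0 : ℂ) r).indicator (fun z => oddField z.re) (-z) =
      -(Metric.closedBall (0 : ℂ) r).indicator (fun z => oddField z.re) z := by
    by_cases hz : ‖z‖ ≤ r <;> simp [indicator, hz, oddField_neg]
  simp only [h2] at h1
  rw [integral_neg] at h1
  linarith

/-- In polar coordinates the radial part integrates to
`2 π ∫ 4 r / (1 + r²)² dr = 4 π`, with primitive `-2 / (1 + r²)`. -/
theorem integrable_radialField_and_integral_eq :
    Integrable (fun z : ℂ => 4 / (1 + ‖z‖ ^ 2) ^ 2) volume ∧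
      ∫ z : ℂ, 4 / (1 + ‖z‖ ^ 2) ^ 2 = 4 * Real.pi := by
  have h1 (y : ℝ) : HasDerivAt (fun y : ℝ => -(2 * (1 + y ^ 2)⁻¹))
      (y ^ (Module.finrank ℝ ℂ - 1) • (4 / (1 + y ^ 2) ^ 2)) y := by
    have h0 : 1 + y ^ 2 ≠ 0 := by positivity
    have h := ((((hasDerivAt_pow 2 y).const_add 1).inv h0).const_mul 2).neg
    refine h.congr_deriv ?_
    simp only [Complex.finrank_real_complex, smul_eq_mul]
    field_simp
    push_cast
    ring
  have h2 : ∀ y ∈ Ioi (0 : ℝ), 0 ≤ y ^ (Module.finrank ℝ ℂ - 1) • (4 / (1 + y ^ 2) ^ 2) := by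
    intro y hy
    have := le_of_lt (mem_Ioi.1 hy)
    rw [smul_eq_mul]
    positivity
  have h3 : Tendsto (fun y : ℝ => -(2 * (1 + y ^ 2)⁻¹)) atTop (𝓝 0) := by
    have h4 : Tendsto (fun y : ℝ => 1 + y ^ 2) atTop atTop :=
      tendsto_atTop_add_const_left _ _ (tendsto_pow_atTop two_ne_zero)
    simpa using (h4.inv_tendsto_atTop.const_mul 2).neg
  constructor
  · exact (integrable_fun_norm_addHaar volume (f := fun y : ℝ => 4 / (1 + y ^ 2) ^ 2)).2
      (integrableOn_Ioi_deriv_of_nonneg' (fun y _ => h1 y) h2 h3)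
  · rw [integral_fun_norm_addHaar volume (fun y : ℝ => 4 / (1 + y ^ 2) ^ 2),
      integral_Ioi_of_hasDerivAt_of_nonneg' (fun y _ => h1 y) h2 h3]
    have h5 : volume.real (Metric.ball (0 : ℂ) 1) = Real.pi := by
      simp [measureReal_def, Complex.volume_ball]
    rw [h5, Complex.finrank_real_complex]
    simp
    ring

theorem tendsto_flux_baseField :
    Tendsto (fun r : ℝ => 1 / (2 * Real.pi) * ∫ z in Metric.closedBall (0 : ℂ) r, baseField z)
      atTop (𝓝 2) := by
  obtain ⟨hi, hv⟩ := integrable_radialField_and_integral_eq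
  have h1 := (aecover_closedBall (μ := (volume : Measure ℂ)) (x := 0)
    tendsto_id).integral_tendsto_of_countably_generated hi
  rw [hv] at h1
  have h2 := h1.const_mul (1 / (2 * Real.pi))
  have h3 : 1 / (2 * Real.pi) * (4 * Real.pi) = 2 := by
    field_simp
    norm_num
  rw [h3] at h2
  refine h2.congr fun r => ?_
  simp only [baseField, id]
  rw [integral_add hi.integrableOn, setIntegral_oddField, add_zero]
  exact (continuous_oddField.comp Complex.continuous_re).continuousOn.integrableOn_compact
    (isCompact_closedBall _ _)

theorem contDiff_basePotential : ContDiff ℝ ∞ basePotential := by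
  have h1 : ContDiff ℝ ∞ (fun z : ℂ => Real.log (1 + ‖z‖ ^ 2)) :=
    (contDiff_const.add (contDiff_norm_sq ℝ)).log fun z => by positivity
  have h2 : ContDiff ℝ ∞ oddProfile := (contDiff_id.pow 2).mul Real.contDiff_arctan
  exact h1.add (h2.comp Complex.reCLM.contDiff)

theorem hasDerivAt_deriv_oddProfile (x : ℝ) :
    HasDerivAt (fun x => 2 * x * Real.arctan x + x ^ 2 / (1 + x ^ 2)) (oddField x) x := by
  have h0 : 1 + x ^ 2 ≠ 0 := by positivity
  have h := (((hasDerivAt_id x).const_mul 2).mul (Real.hasDerivAt_arctan x)).add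
    ((hasDerivAt_pow 2 x).div ((hasDerivAt_pow 2 x).const_add 1) h0)
  refine h.congr_deriv ?_
  simp only [oddField, id]
  field_simp
  push_cast
  ring

theorem laplacian_basePotential (z : ℂ) :
    Laplacian.laplacian basePotential z = baseField z := by
  have hq (y : ℂ) : HasFDerivAt (fun y : ℂ => 1 + ‖y‖ ^ 2) (2 • innerSL ℝ y) y :=
    (hasStrictFDerivAt_norm_sq y).hasFDerivAt.const_add 1
  have hne (y : ℂ) : 1 + ‖y‖ ^ 2 ≠ 0 := by positivity
  have hre (y : ℂ) : HasFDerivAt (fun y : ℂ => y.re) Complex.reCLM y :=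
    Complex.reCLM.hasFDerivAt
  have him (y : ℂ) : HasFDerivAt (fun y : ℂ => y.im) Complex.imCLM y :=
    Complex.imCLM.hasFDerivAt
  have hfd (y v : ℂ) : fderiv ℝ basePotential y v = (1 + ‖y‖ ^ 2)⁻¹ * (2 * inner ℝ y v) +
      (2 * y.re * Real.arctan y.re + y.re ^ 2 / (1 + y.re ^ 2)) * v.re := by
    have h1 := ((hq y).log (hne y)).add ((hasDerivAt_oddProfile y.re).comp_hasFDerivAt y (hre y))
    rw [HasFDerivAt.fderiv (f := basePotential) h1]
    simp
    left
    ring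
  have h1 : (fun y => fderiv ℝ basePotential y 1) = fun y => (1 + ‖y‖ ^ 2)⁻¹ * (2 * y.re) +
      (2 * y.re * Real.arctan y.re + y.re ^ 2 / (1 + y.re ^ 2)) := by
    funext y
    rw [hfd]
    simp [Complex.inner]
  have hI : (fun y => fderiv ℝ basePotential y Complex.I) =
      fun y => (1 + ‖y‖ ^ 2)⁻¹ * (2 * y.im) := by
    funext y
    rw [hfd]
    simp [Complex.inner]
  have hinv : HasFDerivAt (fun y : ℂ => (1 + ‖y‖ ^ 2)⁻¹)
      (-((1 + ‖z‖ ^ 2) ^ 2)⁻¹ • (2 • innerSL ℝ z)) z :=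
    (hasDerivAt_inv (hne z)).comp_hasFDerivAt z (hq z)
  have h2 := (hinv.mul ((hre z).const_mul 2)).add
    ((hasDerivAt_deriv_oddProfile z.re).comp_hasFDerivAt z (hre z))
  have h3 := hinv.mul ((him z).const_mul 2)
  rw [laplacian_eq_fderiv_fderiv (contDiff_infty.1 contDiff_basePotential 2), h1, hI,
    HasFDerivAt.fderiv (f := fun y : ℂ => (1 + ‖y‖ ^ 2)⁻¹ * (2 * y.re) +
      (2 * y.re * Real.arctan y.re + y.re ^ 2 / (1 + y.re ^ 2))) h2,
    HasFDerivAt.fderiv (f := fun y : ℂ => (1 + ‖y‖ ^ 2)⁻¹ * (2 * y.im)) h3]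
  have h4 : ‖z‖ ^ 2 = z.re ^ 2 + z.im ^ 2 := by
    rw [Complex.sq_norm, Complex.normSq_apply]
    ring
  have h5 := hne z
  rw [h4] at h5
  simp [Complex.inner, baseField, h4]
  field_simp
  ring

theorem integral_mul_fderiv_of_hasCompactSupport {f φ : ℂ → ℝ} (hf : ContDiff ℝ ∞ f)
    (hφ : ContDiff ℝ ∞ φ) (hc : HasCompactSupport φ) (v : ℂ) :
    ∫ z, f z * fderiv ℝ φ z v = - ∫ z, fderiv ℝ f z v * φ z := by
  have h1 := (contDiff_fderiv_apply hf v).continuous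
  have h2 := (contDiff_fderiv_apply hφ v).continuous
  refine integral_mul_fderiv_eq_neg_fderiv_mul_of_integrable ?_ ?_ ?_
    (fun x _ => hf.differentiable (by simp) x) (fun x _ => hφ.differentiable (by simp) x)
  · exact (h1.mul hφ.continuous).integrable_of_hasCompactSupport hc.mul_left
  · exact (hf.continuous.mul h2).integrable_of_hasCompactSupport (hc.fderiv_apply ℝ v).mul_left
  · exact (hf.continuous.mul hφ.continuous).integrable_of_hasCompactSupport hc.mul_left

/-- **Green's second identity** against a compactly supported function. -/
theorem integral_mul_laplacian_of_hasCompactSupport {f φ : ℂ → ℝ} (hf : ContDiff ℝ ∞ f)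
    (hφ : ContDiff ℝ ∞ φ) (hc : HasCompactSupport φ) :
    ∫ z, f z * Laplacian.laplacian φ z = ∫ z, Laplacian.laplacian f z * φ z := by
  have h1 (v : ℂ) : ∫ z, f z * fderiv ℝ (fun y => fderiv ℝ φ y v) z v =
      ∫ z, fderiv ℝ (fun y => fderiv ℝ f y v) z v * φ z := by
    rw [integral_mul_fderiv_of_hasCompactSupport hf (contDiff_fderiv_apply hφ v)
      (hc.fderiv_apply ℝ v), integral_mul_fderiv_of_hasCompactSupport (contDiff_fderiv_apply hf v)
      hφ hc, neg_neg]
  have h2 (v : ℂ) : Integrable (fun z => f z * fderiv ℝ (fun y => fderiv ℝ φ y v) z v) volume :=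
    (hf.continuous.mul (contDiff_fderiv_apply (contDiff_fderiv_apply hφ v)
      v).continuous).integrable_of_hasCompactSupport ((hc.fderiv_apply ℝ v).fderiv_apply ℝ v).mul_left
  have h3 (v : ℂ) : Integrable (fun z => fderiv ℝ (fun y => fderiv ℝ f y v) z v * φ z) volume :=
    ((contDiff_fderiv_apply (contDiff_fderiv_apply hf v)
      v).continuous.mul hφ.continuous).integrable_of_hasCompactSupport hc.mul_left
  simp only [laplacian_eq_fderiv_fderiv (contDiff_infty.1 hf 2),
    laplacian_eq_fderiv_fderiv (contDiff_infty.1 hφ 2), mul_add, add_mul]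
  rw [integral_add (h2 _) (h2 _), integral_add (h3 _) (h3 _), h1, h1]

theorem isGeneratingPotential_basePotential :
    Pauli.IsGeneratingPotential basePotential baseField where
  locallyIntegrable := contDiff_basePotential.continuous.locallyIntegrable
  integral_eq φ hφ hc := by
    rw [integral_mul_laplacian_of_hasCompactSupport contDiff_basePotential hφ hc]
    simp only [laplacian_basePotential]

/-! ### Zero modes of the Pauli operators -/

/-- Conjugation turns weak solutions of `∂_z f = 0` into weak solutions of `∂_z̄ f = 0`. -/
theorem Pauli.IsWeakWirtinger.conj {f : ℂ → ℂ} (hf : Pauli.IsWeakWirtinger (-Complex.I) f 0) :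
    Pauli.IsWeakWirtinger Complex.I (fun z => conj (f z)) 0 where
  left := fun x => by
    obtain ⟨s, hs, h⟩ := hf.left x
    exact ⟨s, hs, Complex.conjCLE.toContinuousLinearMap.integrable_comp h⟩
  right := locallyIntegrable_zero
  integral_eq φ hφ := by
    have h1 : Pauli.IsTestFunction (fun z => conj (φ z)) :=
      ⟨Complex.conjCLE.contDiff.comp hφ.smooth,
        hφ.compact.comp_left (g := conj) (map_zero _)⟩
    have h2 := hf.integral_eq _ h1
    have h3 (z : ℂ) : Pauli.wirtinger (-Complex.I) (fun z => conj (φ z)) z =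
        conj (Pauli.wirtinger Complex.I φ z) := by
      have h4 : fderiv ℝ (fun z => conj (φ z)) z =
          Complex.conjCLE.toContinuousLinearMap.comp (fderiv ℝ φ z) :=
        (Complex.conjCLE.hasFDerivAt.comp z
          (hφ.smooth.differentiable (by simp) z).hasFDerivAt).fderiv
      simp [Pauli.wirtinger, h4]
      exact Or.inl (Complex.conj_ofNat 2).symm
    simp only [h3, Pi.zero_apply, zero_mul, integral_zero, neg_zero] at h2 ⊢
    have h5 := integral_conj (μ := volume)
      (f := fun z => f z * conj (Pauli.wirtinger Complex.I φ z))
    rw [h2] at h5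
    simpa using h5

/-- Two generating potentials of the same field differ by the real part of an entire function. -/
theorem exists_entire_of_isGeneratingPotential {h h₀ B : ℂ → ℝ}
    (hh : Pauli.IsGeneratingPotential h B) (hh₀ : Pauli.IsGeneratingPotential h₀ B) :
    ∃ F : ℂ → ℂ, Differentiable ℂ F ∧ h =ᵐ[volume] fun z => h₀ z + (F z).re := by
  have hu : LocallyIntegrable (h - h₀) volume := hh.locallyIntegrable.sub hh₀.locallyIntegrable
  obtain ⟨v, hv, huv⟩ := exists_harmonic_ae_eq hu fun φ hφ hc => by
    have hL : Laplacian.laplacian φ = fun z => fderiv ℝ (fun y => fderiv ℝ φ y 1) z 1 +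
        fderiv ℝ (fun y => fderiv ℝ φ y Complex.I) z Complex.I :=
      funext (laplacian_eq_fderiv_fderiv (contDiff_infty.1 hφ 2))
    have hcont : Continuous (Laplacian.laplacian φ) := by
      rw [hL]
      exact (contDiff_fderiv_apply (contDiff_fderiv_apply hφ _) _).continuous.add
        (contDiff_fderiv_apply (contDiff_fderiv_apply hφ _) _).continuous
    have hsupp : HasCompactSupport (Laplacian.laplacian φ) := by
      rw [hL]
      exact ((hc.fderiv_apply ℝ _).fderiv_apply ℝ _).add ((hc.fderiv_apply ℝ _).fderiv_apply ℝ _)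
    have hi {g : ℂ → ℝ} (hg : LocallyIntegrable g volume) :
        Integrable (fun z => g z * Laplacian.laplacian φ z) volume :=
      hg.integrable_smul_right_of_hasCompactSupport hcont hsupp
    simp only [Pi.sub_apply, sub_mul]
    rw [integral_sub (hi hh.locallyIntegrable) (hi hh₀.locallyIntegrable),
      hh.integral_eq φ hφ hc, hh₀.integral_eq φ hφ hc, sub_self]
  obtain ⟨F, hF, rfl⟩ := InnerProductSpace.HarmonicOnNhd.exists_analyticOnNhd_univ_re_eq hv
  refine ⟨F, fun z => (hF z (mem_univ z)).differentiableAt, ?_⟩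
  filter_upwards [huv] with z hz
  rw [← hz, Pi.sub_apply]
  ring

theorem componentForm_self {c : ℂ} {h : ℂ → ℝ} {f : ℂ → ℂ} :
    Pauli.componentForm c h f f = ((4 * ∫ z, ‖Pauli.weakWirtinger c (Pauli.twist h f) z‖ ^ 2 *
      Real.exp (2 * h z) : ℝ) : ℂ) := by
  rw [Pauli.componentForm, Complex.ofReal_mul, ← integral_complex_ofReal]
  congr 2
  funext z
  rw [mul_comm (conj _), Complex.mul_conj, Complex.normSq_eq_norm_sq, Complex.ofReal_mul]

theorem isWeakWirtinger_zero_of_integral_eq_zero {c : ℂ} {h : ℂ → ℝ} {f : ℂ → ℂ}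
    (hf : Pauli.HasFiniteEnergy c h f)
    (h0 : ∫ z, ‖Pauli.weakWirtinger c (Pauli.twist h f) z‖ ^ 2 * Real.exp (2 * h z) = 0) :
    Pauli.IsWeakWirtinger c (Pauli.twist h f) 0 := by
  have hw := Pauli.isWeakWirtinger_weakWirtinger hf.exists_weak
  have hi : Integrable (fun z => ‖Pauli.weakWirtinger c (Pauli.twist h f) z‖ ^ 2 *
      Real.exp (2 * h z)) volume := by
    refine (Pauli.integrable_componentForm hf hf).norm.congr (.of_forall fun z => ?_)
    simp only [norm_mul, RCLike.norm_conj, Complex.norm_real, Real.norm_eq_abs, Real.abs_exp]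
    ring
  have h1 := (integral_eq_zero_iff_of_nonneg (fun z => by positivity) hi).1 h0
  have h2 : Pauli.weakWirtinger c (Pauli.twist h f) =ᵐ[volume] 0 := by
    filter_upwards [h1] with z hz
    have h3 := (mul_eq_zero.1 hz).resolve_right (Real.exp_pos _).ne'
    simpa using h3
  refine ⟨hw.left, locallyIntegrable_zero, fun φ hφ => ?_⟩
  rw [hw.integral_eq φ hφ]
  congr 1
  refine integral_congr_ae ?_
  filter_upwards [h2] with z hz
  rw [hz]

/-- On the kernel of `H_h` the form vanishes, and so do both of its nonnegative terms. -/
theorem isWeakWirtinger_zero_of_mem_pauliKernel {h : ℂ → ℝ}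
    (ψ : (Pauli.pauliOperator h).domain) (hψ : ψ ∈ Pauli.pauliKernel h) :
    Pauli.IsWeakWirtinger Complex.I (Pauli.twist h (Pauli.up ψ)) 0 ∧
      Pauli.IsWeakWirtinger (-Complex.I) (Pauli.twist (-h) (Pauli.down ψ)) 0 := by
  have h1 : ((ψ : Pauli.Spinor), (0 : Pauli.Spinor)) ∈ Pauli.pauliGraph h := by
    rw [← Pauli.pauliOperator_graph, LinearPMap.mem_graph_iff]
    exact ⟨ψ, rfl, hψ⟩
  obtain ⟨h2, -, h3⟩ := h1
  have h4 := h3 ψ h2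
  rw [inner_zero_left, Pauli.pauliForm, componentForm_self, componentForm_self,
    ← Complex.ofReal_add, eq_comm, Complex.ofReal_eq_zero] at h4
  have h5 : 0 ≤ ∫ z, ‖Pauli.weakWirtinger Complex.I (Pauli.twist h (Pauli.up ψ)) z‖ ^ 2 *
      Real.exp (2 * h z) := integral_nonneg fun z => by positivity
  have h6 : 0 ≤ ∫ z, ‖Pauli.weakWirtinger (-Complex.I) (Pauli.twist (-h) (Pauli.down ψ)) z‖ ^ 2 *
      Real.exp (2 * (-h) z) := integral_nonneg fun z => by positivity
  exact ⟨isWeakWirtinger_zero_of_integral_eq_zero h2.1 (by linarith),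
    isWeakWirtinger_zero_of_integral_eq_zero h2.2 (by linarith)⟩

theorem integrable_norm_sq_coord (ψ : Pauli.Spinor) (i : Fin 2) :
    Integrable (fun z => ‖ψ z i‖ ^ 2) volume := by
  have h := (EuclideanSpace.proj i : EuclideanSpace ℂ (Fin 2) →L[ℂ] ℂ).comp_memLp' (Lp.memLp ψ)
  exact (memLp_two_iff_integrable_sq_norm h.1).1 h

theorem exp_two_mul_basePotential (z : ℂ) : Real.exp (2 * basePotential z) =
    (1 + ‖z‖ ^ 2) ^ 2 * Real.exp (2 * oddProfile z.re) := by
  rw [basePotential, mul_add, Real.exp_add]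
  congr 1
  rw [← Nat.cast_ofNat, Real.exp_nat_mul, Real.exp_log (by positivity)]

theorem norm_exp_sq (w : ℂ) : ‖Complex.exp w‖ ^ 2 = Real.exp (2 * w.re) := by
  rw [Complex.norm_exp, ← Real.exp_nat_mul]
  norm_num

/-- There is no spin-up zero mode. -/
theorem ae_eq_zero_of_isWeakWirtinger_up {h : ℂ → ℝ} {F : ℂ → ℂ} (hF : Differentiable ℂ F)
    (hh : h =ᵐ[volume] fun z => basePotential z + (F z).re) {f : ℂ → ℂ}
    (hf : Integrable (fun z => ‖f z‖ ^ 2) volume)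
    (hw : Pauli.IsWeakWirtinger Complex.I (Pauli.twist h f) 0) : f =ᵐ[volume] 0 := by
  obtain ⟨g, hg, hfg⟩ := exists_differentiable_ae_eq hw
  have hk : Differentiable ℂ (fun z => Complex.exp (F z) * g z) := hF.cexp.mul hg
  have hk0 := eq_zero_of_integrable_weight hk <| by
    refine Integrable.mono' hf ?_ ?_
    · have h1 : Continuous (fun z : ℂ => ((1 + ‖z‖ ^ 2) ^ 2)⁻¹) := by
        have h2 (z : ℂ) : (1 + ‖z‖ ^ 2) ^ 2 ≠ 0 := by positivity
        fun_prop (disch := assumption)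
      have h3 : Continuous oddProfile :=
        continuous_iff_continuousAt.2 fun x => (hasDerivAt_oddProfile x).continuousAt
      have h4 := hk.continuous
      exact (((h4.norm.pow 2).mul h1).mul (Real.continuous_exp.comp
        ((h3.comp Complex.continuous_re).const_mul 2))).aestronglyMeasurable
    · filter_upwards [hh, hfg] with z hz hz'
      have h1 : ‖g z‖ ^ 2 = Real.exp (-(2 * basePotential z)) * Real.exp (-(2 * (F z).re)) *
          ‖f z‖ ^ 2 := by
        rw [← hz', Pauli.twist, norm_mul, mul_pow, Complex.norm_real, Real.norm_eq_abs,
          Real.abs_exp, ← Real.exp_nat_mul, ← Real.exp_add, hz]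
        congr 2
        push_cast
        ring
      rw [Real.norm_of_nonneg (by positivity), norm_mul, mul_pow, norm_exp_sq, h1, Real.exp_neg,
        Real.exp_neg, exp_two_mul_basePotential]
      have h2 : 1 ≤ (1 + ‖z‖ ^ 2) ^ 2 := one_le_pow₀ (by nlinarith [sq_nonneg ‖z‖])
      have h3 : ((1 + ‖z‖ ^ 2) ^ 2)⁻¹ ≤ 1 := inv_le_one_of_one_le₀ h2
      have h4 : 0 ≤ ((1 + ‖z‖ ^ 2) ^ 2)⁻¹ := by positivity
      calc _ = ‖f z‖ ^ 2 * (((1 + ‖z‖ ^ 2) ^ 2)⁻¹ * ((1 + ‖z‖ ^ 2) ^ 2)⁻¹) := by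
            field_simp
        _ ≤ ‖f z‖ ^ 2 * 1 := by
            gcongr
            exact mul_le_one₀ h3 h4 h3
        _ = _ := mul_one _
  filter_upwards [hfg] with z hz
  have h1 := (mul_eq_zero.1 (congrFun hk0 z)).resolve_left (Complex.exp_ne_zero _)
  rw [h1, Pauli.twist] at hz
  exact (mul_eq_zero.1 hz).resolve_left (Complex.ofReal_ne_zero.2 (Real.exp_pos _).ne')

/-- There is no spin-down zero mode. The reflection `z ↦ -z` fixes the radial part of the potential
and changes the sign of its odd part, which exchanges the roles of the half-planes. -/
theorem ae_eq_zero_of_isWeakWirtinger_down {h : ℂ → ℝ} {F : ℂ → ℂ} (hF : Differentiable ℂ F)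
    (hh : h =ᵐ[volume] fun z => basePotential z + (F z).re) {f : ℂ → ℂ}
    (hf : Integrable (fun z => ‖f z‖ ^ 2) volume)
    (hw : Pauli.IsWeakWirtinger (-Complex.I) (Pauli.twist (-h) f) 0) : f =ᵐ[volume] 0 := by
  obtain ⟨g, hg, hfg⟩ := exists_differentiable_ae_eq hw.conj
  have hk : Differentiable ℂ (fun z => Complex.exp (-F z) * g z) := hF.neg.cexp.mul hg
  have hint : Integrable (fun z => ‖Complex.exp (-F z) * g z‖ ^ 2 * ((1 + ‖z‖ ^ 2) ^ 2)⁻¹ *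
      Real.exp (2 * oddProfile (-z).re)) volume := by
    refine hf.congr ?_
    filter_upwards [hh, hfg] with z hz hz'
    have h1 : ‖g z‖ ^ 2 = Real.exp (2 * basePotential z) * Real.exp (2 * (F z).re) *
        ‖f z‖ ^ 2 := by
      rw [← hz', Pauli.twist, RCLike.norm_conj, norm_mul, mul_pow, Complex.norm_real,
        Real.norm_eq_abs, Real.abs_exp, ← Real.exp_nat_mul, ← Real.exp_add, Pi.neg_apply, hz]
      congr 2
      push_cast
      ring
    rw [norm_mul, mul_pow, norm_exp_sq, h1, exp_two_mul_basePotential, Complex.neg_re,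
      Complex.neg_re, oddProfile_neg, mul_neg, mul_neg, Real.exp_neg, Real.exp_neg]
    field_simp
  have hk0 := eq_zero_of_integrable_weight (hk.comp differentiable_neg) <| by
    refine hint.comp_neg.congr (.of_forall fun z => ?_)
    simp
  filter_upwards [hfg] with z hz
  have h1 : Complex.exp (-F z) * g z = 0 := by simpa using congrFun hk0 (-z)
  have h2 := (mul_eq_zero.1 h1).resolve_left (Complex.exp_ne_zero _)
  rw [h2, map_eq_zero, Pauli.twist] at hz
  exact (mul_eq_zero.1 hz).resolve_left (Complex.ofReal_ne_zero.2 (Real.exp_pos _).ne')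

theorem pauliKernel_eq_bot {h : ℂ → ℝ} (hh : Pauli.IsGeneratingPotential h baseField) :
    Pauli.pauliKernel h = ⊥ := by
  obtain ⟨F, hF, hhF⟩ :=
    exists_entire_of_isGeneratingPotential hh isGeneratingPotential_basePotential
  refine (Submodule.eq_bot_iff _).2 fun ψ hψ => ?_
  obtain ⟨h1, h2⟩ := isWeakWirtinger_zero_of_mem_pauliKernel ψ hψ
  have h3 := ae_eq_zero_of_isWeakWirtinger_up hF hhF (integrable_norm_sq_coord ψ 0) h1
  have h4 := ae_eq_zero_of_isWeakWirtinger_down hF hhF (integrable_norm_sq_coord ψ 1) h2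
  refine Subtype.ext (Lp.ext ?_)
  filter_upwards [h3, h4, Lp.coeFn_zero (EuclideanSpace ℂ (Fin 2)) 2 (volume : Measure ℂ)]
    with z hz hz' hz0
  rw [Submodule.coe_zero, hz0]
  ext i
  fin_cases i
  · exact hz
  · exact hz'

theorem mainTheorem4 :
    ∃ (B : ℂ → ℝ) (Φ : ℝ),
      Continuous B ∧
      (∃ C : ℝ, ∀ z, |B z| ≤ C) ∧
      ∫⁻ z, ENNReal.ofReal |B z| = ⊤ ∧
      Tendsto (fun r : ℝ => 1 / (2 * Real.pi) * ∫ z in Metric.closedBall (0 : ℂ) r, B z)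
        atTop (𝓝 Φ) ∧
      1 < Φ ∧
      (∃ h : ℂ → ℝ, Pauli.IsGeneratingPotential h B) ∧
      ∀ h : ℂ → ℝ, Pauli.IsGeneratingPotential h B →
        Module.rank ℂ (Pauli.pauliKernel h) = 0 ∧
        Module.rank ℂ (Pauli.pauliKernel h) ≠ (Pauli.strictFloor |Φ| : Cardinal) := by
  refine ⟨baseField, 2, continuous_baseField, ⟨12, abs_baseField_le⟩, lintegral_abs_baseField,
    tendsto_flux_baseField, by norm_num, ⟨_, isGeneratingPotential_basePotential⟩, fun h hh => ?_⟩
  have h1 : Module.rank ℂ (Pauli.pauliKernel h) = 0 := by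
    rw [pauliKernel_eq_bot hh, rank_bot]
  have h2 : Pauli.strictFloor |2| = 1 := by
    simp [Pauli.strictFloor]
  rw [h1, h2]
  simp
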